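/- Let $\mathbb{D}$ be the open unit disc, $0<p\le\infty$, $-1\le\alpha<\infty$, and let $N\ge 0$ be an integer. For $f$ holomorphic on $\mathbb{D}$ put $$\|f\|_{p,\alpha}=\Big(\int_{\mathbb{D}}|f(z)|^p\,\frac{1+\alpha}{\pi}(1-|z|^2)^\alpha\,dx\,dy\Big)^{1/p}\quad(p<\infty,\ \alpha>-1),$$ $$\|f\|_{p,-1}=\sup_{0<r<1}\Big(\frac1{2\pi}\int_0^{2\pi}|f(re^{i\theta})|^p\,d\theta\Big)^{1/p}\quad(p<\infty),\qquad \|f\|_{\infty,\alpha}=\sup_{z\in\mathbb{D}}|f(z)|,$$ and let $A^p_\alpha$ be the space of holomorphic $f$ on $\mathbb{D}$ with $\|f\|_{p,\alpha}<\infty$ (so $A^p_{-1}=H^p$ is the Hardy space). Write $\frac{2+\alpha}{p}=0$ if $p=\infty$. There is a constant $C_{N,p,\alpha}$, depending only on $N$, $p$ and $\alpha$, such that to all points $\lambda_0,\dots,\lambda_N\in\mathbb{D}$ (not necessarily distinct) and every $0\le J\le N$ one can assign a function $f=f_{\lambda_0,\dots,\lambda_N;J}\in A^p_\alpha$ with $\|f\|_{p,\alpha}\le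 C_{N,p,\alpha}$, $$f^{(J)}(\lambda_J)=\frac{1}{(1-|\lambda_J|^2)^{\frac{2+\alpha}{p}+J}},\qquad f^{(k)}(\lambda_k)=0\quad\text{for } 0\le k\le N,\ k\ne J,$$ in such a way that moreover, for each $J$ and each compact $K\subset\mathbb{D}$, $f_{\lambda_0,\dots,\lambda_N;J}\to0$ uniformly on $K$ as $\min\{|\lambda_j|:0\le j\le N\}\to1$; that is, for every $\varepsilon>0$ there is $r<1$ such that $|f_{\lambda_0,\dots,\lambda_N;J}(z)|<\varepsilon$ for all $z\in K$ whenever $\min_j|\lambda_j|>r$. -/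

import Mathlib

open MeasureTheory Filter Topology Metric
open scoped ENNReal NNReal

noncomputable section

/-- The measure `dA_α = (1 + α) (1 - |z|²)^α dA` on the open unit disc, where
`dA = dx dy / π`; it is extended by zero to the whole plane. It is used for `-1 < α`. -/
def discMeasure (α : ℝ) : Measure ℂ :=
  (volume.restrict (ball (0 : ℂ) 1)).withDensity
    (fun z => ENNReal.ofReal ((1 + α) * (1 - ‖z‖ ^ 2) ^ α / Real.pi))

/-- The norm of the Hardy space `H^p` for `0 < p < ∞`: the supremum over `0 < r < 1` of the
`L^p` norms of `θ ↦ f (r e^{iθ})` with respect to `dθ / 2π` on `(0, 2π]`. -/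
def hardyNorm (p : ℝ≥0∞) (f : ℂ → ℂ) : ℝ≥0∞ :=
  ⨆ r ∈ Set.Ioo (0 : ℝ) 1,
    eLpNorm (fun θ : ℝ => f (circleMap 0 r θ)) p
      ((ENNReal.ofReal (2 * Real.pi))⁻¹ • volume.restrict (Set.Ioc 0 (2 * Real.pi)))

open Classical in
/-- The extended norm `‖f‖_{p,α}` for `0 < p ≤ ∞` and `-1 ≤ α < ∞`: the supremum norm on the disc
if `p = ∞`; otherwise the `H^p` norm if `α = -1`, and the `L^p(dA_α)` norm if `-1 < α`. -/
def bergmanNorm (p : ℝ≥0∞) (α : ℝ) (f : ℂ → ℂ) : ℝ≥0∞ :=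
  if p = ∞ then ⨆ z ∈ ball (0 : ℂ) 1, ‖f z‖ₑ
  else if α = -1 then hardyNorm p f
  else eLpNorm f p (discMeasure α)

/-- Membership in the weighted Bergman space `A^p_α` (with `A^p_{-1} = H^p` and
`A^∞_α = H^∞`): holomorphic on the open unit disc with finite norm. Values of `f` outside the
disc play no role. -/
structure MemBergman (p : ℝ≥0∞) (α : ℝ) (f : ℂ → ℂ) : Prop where
  holomorphic : DifferentiableOn ℂ f (ball (0 : ℂ) 1)
  norm_lt_top : bergmanNorm p α f < ∞

/-- `min {|λ_j| : 0 ≤ j ≤ N}` for points `λ_0, …, λ_N` of the unit disc. -/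
def minModulus {N : ℕ} (l : Fin (N + 1) → Complex.UnitDisc) : ℝ :=
  Finset.univ.inf' Finset.univ_nonempty (fun j => ‖(l j : ℂ)‖)

end

/-! ### Abel–Gontscharoff polynomials and Hermite interpolation -/

/-! Fix J, put a = λ_J and d = 1 - |a|², and move a to 0 by `discAut a`. The moduli of the N + 1
image points leave a gap whose width depends only on N, and this gap splits the points into near and
far ones. The near points lie in a Euclidean disc of radius O(d) about a. There a polynomial of
degree J (`exists_abelGontscharoff`) meets their conditions and is O(d^J), which compensates the
required factor d^(-J). Far points are handled by a product A with zeros of order N + 1.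

To combine the two, the target is divided by A and by (1 + conj a * w)^m on a disc that ends inside
the gap. The quotient is replaced by a Hermite interpolant that is bounded on the whole unit disc
(`exists_hermite_interpolation`), and the factors are multiplied back. This is `exists_interpolant`;
its bounds do not depend on the position of the points.

In the original variable the power is (d / (1 - conj a * z))^m. After multiplication by d^(-s), s =
(2 + α)/p, it is bounded in the norm uniformly in a (`exists_bergmanNorm_le_of_le_kernel`, for m ≥
2s), and on compact sets it is O(d^(m - s)), which tends to 0 when m > s. -/

theorem Polynomial.derivative_surjective_complex :
    Function.Surjective (Polynomial.derivative : Polynomial ℂ → Polynomial ℂ) := by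
  intro p
  induction p using Polynomial.induction_on' with
  | add p q hp hq =>
    obtain ⟨P, rfl⟩ := hp
    obtain ⟨Q, rfl⟩ := hq
    exact ⟨P + Q, Polynomial.derivative_add⟩
  | monomial n a =>
    refine ⟨Polynomial.monomial (n + 1) (a / (n + 1)), ?_⟩
    rw [Polynomial.derivative_monomial]
    congr 1
    push_cast
    have : (n : ℂ) + 1 ≠ 0 := by exact_mod_cast n.succ_ne_zero
    field_simp

/-- Existence of Abel–Gontscharoff polynomials with nodes in a disc, with a uniform bound. -/
theorem exists_abelGontscharoff (c : ℂ) {ρ : ℝ} (hρ : 0 ≤ ρ) (J : ℕ) (v : ℕ → ℂ)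
    (hv : ∀ k, v k ∈ closedBall c ρ) :
    ∃ P : Polynomial ℂ, (∀ z, iteratedDeriv J (fun z => P.eval z) z = 1) ∧
      (∀ k < J, iteratedDeriv k (fun z => P.eval z) (v k) = 0) ∧
      ∀ z ∈ closedBall c ρ, ‖P.eval z‖ ≤ (2 * ρ) ^ J := by
  induction J generalizing v with
  | zero => exact ⟨1, by simp, by simp, by simp⟩
  | succ J ih =>
    obtain ⟨P, h1, h2, h3⟩ := ih (fun k => v (k + 1)) (fun k => hv _)
    -- Integrate the polynomial for the shifted nodes and normalise at `v 0`; each integration costs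
    -- at most the diameter 2ρ.
    obtain ⟨Q, hQ⟩ := Polynomial.derivative_surjective_complex P
    have hd : deriv (fun z => (Q - Polynomial.C (Q.eval (v 0))).eval z) = fun z => P.eval z := by
      ext z
      rw [Polynomial.deriv]
      simp [hQ]
    refine ⟨Q - Polynomial.C (Q.eval (v 0)), ?_, ?_, ?_⟩
    · intro z
      rw [iteratedDeriv_succ', hd, h1]
    · rintro (_ | k) hk
      · simp
      · rw [iteratedDeriv_succ', hd]
        exact h2 k (by omega)
    · intro z hz
      have := (convex_closedBall c ρ).norm_image_sub_le_of_norm_deriv_le (𝕜 := ℂ)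
        (f := fun z => (Q - Polynomial.C (Q.eval (v 0))).eval z) (C := (2 * ρ) ^ J)
        (fun x _ => Polynomial.differentiableAt _) (fun x hx => by rw [hd]; exact h3 x hx)
        (hv 0) hz
      have h0 : (Q - Polynomial.C (Q.eval (v 0))).eval (v 0) = 0 := by simp
      simp only [h0, sub_zero] at this
      refine this.trans ?_
      rw [pow_succ]
      have hz' : ‖z - v 0‖ ≤ 2 * ρ := by
        rw [← dist_eq_norm]
        have := dist_triangle_right z (v 0) c
        have h1 := mem_closedBall.1 hz
        have h2 := mem_closedBall.1 (hv 0)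
        linarith
      gcongr

/-- Within distance r' - r of ζ this is the Schwarz lemma; farther away the denominator is at least
r' - r. The ball does not shrink, so the bound can be iterated. -/
theorem norm_dslope_le_of_norm_le {Φ : ℂ → ℂ} {r r' M : ℝ} {ζ z : ℂ} (hr : r < r')
    (hΦ : DifferentiableOn ℂ Φ (ball 0 r')) (hM : ∀ z ∈ ball (0 : ℂ) r', ‖Φ z‖ ≤ M)
    (hζ : ‖ζ‖ ≤ r) (hz : z ∈ ball (0 : ℂ) r') : ‖dslope Φ ζ z‖ ≤ 2 * M / (r' - r) := by
  have hζ' : ζ ∈ ball (0 : ℂ) r' := by rw [mem_ball_zero_iff]; linarith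
  have hsub : ball ζ (r' - r) ⊆ ball 0 r' := by
    apply ball_subset_ball'
    rw [dist_zero_right]; linarith
  have hle : ∀ z ∈ ball (0 : ℂ) r', ‖Φ z - Φ ζ‖ ≤ 2 * M := fun z hz =>
    (norm_sub_le _ _).trans (by linarith [hM z hz, hM ζ hζ'])
  by_cases h : z ∈ ball ζ (r' - r)
  · refine Complex.norm_dslope_le_div_of_mapsTo_ball (hΦ.mono hsub) (fun y hy => ?_) h
    rw [mem_closedBall, dist_eq_norm]
    exact hle y (hsub hy)
  · rw [mem_ball, not_lt, dist_eq_norm] at h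
    have hne : z ≠ ζ := by
      rintro rfl
      simp at h; linarith
    rw [dslope_of_ne _ hne, slope_def_field, norm_div]
    have := (norm_nonneg _).trans (hle z hz)
    have := sub_pos.2 hr
    exact div_le_div₀ ‹_› (hle z hz) this h

/-- Hermite interpolation at nodes in a disc with a bound depending only on the number of nodes
and on the distance of the nodes to the complement of the domain. -/
theorem exists_hermite_interpolation {δ : ℝ} (hδ : 0 < δ) (n : ℕ) :
    ∃ D : ℝ, 0 ≤ D ∧ ∀ (r r' : ℝ), r ≤ 1 → r + δ ≤ r' → ∀ s : Multiset ℂ, s.card = n →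
      (∀ ζ ∈ s, ‖ζ‖ ≤ r) → ∀ (Φ : ℂ → ℂ) (M : ℝ), DifferentiableOn ℂ Φ (ball 0 r') →
      (∀ z ∈ ball (0 : ℂ) r', ‖Φ z‖ ≤ M) →
      ∃ Q R : ℂ → ℂ, Differentiable ℂ Q ∧ (∀ z ∈ ball (0 : ℂ) 1, ‖Q z‖ ≤ D * M) ∧
        DifferentiableOn ℂ R (ball 0 r') ∧
        ∀ z ∈ ball (0 : ℂ) r', Φ z = Q z + (s.map (fun ζ => z - ζ)).prod * R z := by
  induction n with
  | zero =>
    refine ⟨0, le_rfl, fun r r' _ _ s hs _ Φ M hΦ _ => ⟨0, Φ, ?_⟩⟩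
    rw [Multiset.card_eq_zero.1 hs]
    exact ⟨differentiable_const 0, by simp, hΦ, by simp⟩
  | succ n ih =>
    obtain ⟨D, hD, ih⟩ := ih
    refine ⟨1 + 4 * D / δ, by positivity, fun r r' hr hr' s hs hsr Φ M hΦ hM => ?_⟩
    obtain ⟨ζ, hζs⟩ := Multiset.card_pos_iff_exists_mem.1 (by omega : 0 < s.card)
    obtain ⟨t, rfl⟩ := Multiset.exists_cons_of_mem hζs
    have hζ : ‖ζ‖ ≤ r := hsr ζ (Multiset.mem_cons_self _ _)
    have hζ' : ζ ∈ ball (0 : ℂ) r' := by rw [mem_ball_zero_iff]; linarith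
    have hM0 : 0 ≤ M := (norm_nonneg _).trans (hM ζ hζ')
    -- Newton's scheme: peel off one node and interpolate the divided difference at the remaining
    -- ones.
    obtain ⟨Q, R, hQ, hQM, hR, h⟩ := ih r r' hr hr' t (by simpa using hs)
      (fun x hx => hsr x (Multiset.mem_cons_of_mem hx)) (dslope Φ ζ) (2 * M / δ)
      ((Complex.differentiableOn_dslope (isOpen_ball.mem_nhds hζ')).2 hΦ)
      (fun z hz => (norm_dslope_le_of_norm_le (by linarith) hΦ hM hζ hz).trans
        (by gcongr; linarith))
    refine ⟨fun z => Φ ζ + (z - ζ) * Q z, R, by fun_prop, fun z hz => ?_, hR, fun z hz => ?_⟩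
    · have hz1 : ‖z - ζ‖ ≤ 2 := by
        rw [mem_ball_zero_iff] at hz
        exact (norm_sub_le _ _).trans (by linarith)
      calc ‖Φ ζ + (z - ζ) * Q z‖ ≤ ‖Φ ζ‖ + ‖z - ζ‖ * ‖Q z‖ := by
            rw [← norm_mul]; exact norm_add_le _ _
        _ ≤ M + 2 * (D * (2 * M / δ)) := by
            gcongr
            · exact hM ζ hζ'
            · exact hQM z hz
        _ = (1 + 4 * D / δ) * M := by ring
    · have hds := sub_smul_dslope Φ ζ z
      rw [h z hz, smul_eq_mul] at hds
      rw [Multiset.map_cons, Multiset.prod_cons]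
      linear_combination -hds

/-- A function that is locally a product with `(g · - g a) ^ n` has vanishing derivatives of order
less than `n`. -/
theorem iteratedDeriv_eq_zero_of_eventuallyEq_pow_mul {f g h : ℂ → ℂ} {a : ℂ} {n k : ℕ}
    (hk : k < n) (hg : AnalyticAt ℂ g a) (hga : g a = 0) (hh : AnalyticAt ℂ h a)
    (hf : f =ᶠ[𝓝 a] fun z => g z ^ n * h z) : iteratedDeriv k f a = 0 := by
  rw [hf.iteratedDeriv_eq]
  have hgn : AnalyticAt ℂ (fun z => g z ^ n) a := hg.pow n
  refine (natCast_le_analyticOrderAt_iff_iteratedDeriv_eq_zero (hgn.mul hh)).1 ?_ k hk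
  rw [analyticOrderAt_mul hgn hh]
  refine le_add_right ?_
  have : analyticOrderAt (fun z => g z ^ n) a = n • analyticOrderAt g a := analyticOrderAt_pow hg n
  rw [this, nsmul_eq_mul]
  have h1 : 1 ≤ analyticOrderAt g a :=
    Order.one_le_iff_ne_zero.2 (hg.analyticOrderAt_ne_zero.2 hga)
  calc (n : ℕ∞) = n * 1 := (mul_one _).symm
    _ ≤ _ := by gcongr

/-! ### Automorphisms of the unit disc -/

open ComplexConjugate in
/-- The automorphism of the unit disc that sends `l` to `0`. -/
noncomputable def discAut (l z : ℂ) : ℂ := (z - l) / (1 - conj l * z)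

section discAut

open ComplexConjugate

variable {l z w : ℂ}

theorem discAut_self : discAut l l = 0 := by simp [discAut]

theorem norm_conj_mul_lt_one (hl : ‖l‖ < 1) (hz : ‖z‖ ≤ 1) : ‖conj l * z‖ < 1 := by
  rw [norm_mul, RCLike.norm_conj]
  nlinarith [norm_nonneg l, norm_nonneg z]

theorem one_sub_conj_mul_ne_zero (hl : ‖l‖ < 1) (hz : ‖z‖ ≤ 1) : 1 - conj l * z ≠ 0 := by
  intro h
  have := norm_conj_mul_lt_one hl hz
  rw [← sub_eq_zero.1 h] at this
  simp at this

theorem one_add_conj_mul_ne_zero (hl : ‖l‖ < 1) (hz : ‖z‖ ≤ 1) : 1 + conj l * z ≠ 0 := by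
  have := one_sub_conj_mul_ne_zero (l := -l) (by simpa using hl) hz
  simpa using this

theorem one_sub_norm_sq_pos (hl : ‖l‖ < 1) : 0 < 1 - ‖l‖ ^ 2 := by
  nlinarith [norm_nonneg l]

theorem one_sub_norm_sq_discAut (hl : ‖l‖ < 1) (hz : ‖z‖ ≤ 1) :
    1 - ‖discAut l z‖ ^ 2 = (1 - ‖l‖ ^ 2) * (1 - ‖z‖ ^ 2) / ‖1 - conj l * z‖ ^ 2 := by
  have h := one_sub_conj_mul_ne_zero hl hz
  have h' : ‖1 - conj l * z‖ ^ 2 ≠ 0 := by simpa using h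
  rw [discAut, norm_div, div_pow, eq_div_iff h', sub_mul, div_mul_cancel₀ _ h']
  simp only [← Complex.normSq_eq_norm_sq, Complex.normSq_apply, Complex.sub_re, Complex.sub_im,
    Complex.mul_re, Complex.mul_im, Complex.conj_re, Complex.conj_im, Complex.one_re,
    Complex.one_im]
  ring

theorem norm_discAut_lt_one (hl : ‖l‖ < 1) (hz : ‖z‖ < 1) : ‖discAut l z‖ < 1 := by
  have h := one_sub_norm_sq_discAut hl hz.le
  have h' : 0 < ‖1 - conj l * z‖ := norm_pos_iff.2 (one_sub_conj_mul_ne_zero hl hz.le)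
  have : 0 < 1 - ‖discAut l z‖ ^ 2 := by
    rw [h]
    have := one_sub_norm_sq_pos hl
    have := one_sub_norm_sq_pos hz
    positivity
  nlinarith [norm_nonneg (discAut l z)]

/-- Turns a polynomial factor in the moved variable into the kernel that gives decay in the original
one. -/
theorem one_add_conj_mul_discAut (hl : ‖l‖ < 1) (hz : ‖z‖ ≤ 1) :
    1 + conj l * discAut l z = ((1 - ‖l‖ ^ 2 : ℝ) : ℂ) / (1 - conj l * z) := by
  have h := one_sub_conj_mul_ne_zero hl hz
  have hc : conj l * l = (‖l‖ : ℂ) ^ 2 := Complex.conj_mul' l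
  rw [discAut]
  field_simp
  push_cast
  linear_combination -hc

/-- Shows that points well inside the disc are carried to within O(1 - |l|²) of l. -/
theorem discAut_neg_sub (hl : ‖l‖ < 1) (hz : ‖z‖ ≤ 1) :
    discAut (-l) z - l = ((1 - ‖l‖ ^ 2 : ℝ) : ℂ) * z / (1 + conj l * z) := by
  have h := one_add_conj_mul_ne_zero hl hz
  have hc : conj l * l = (‖l‖ : ℂ) ^ 2 := Complex.conj_mul' l
  simp only [discAut, map_neg, neg_mul, sub_neg_eq_add]
  rw [eq_div_iff h, sub_mul, div_mul_cancel₀ _ h]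
  push_cast
  linear_combination -z * hc

theorem discAut_neg_discAut (hl : ‖l‖ < 1) (hz : ‖z‖ ≤ 1) : discAut (-l) (discAut l z) = z := by
  have h := one_sub_conj_mul_ne_zero hl hz
  have hd : ((1 - ‖l‖ ^ 2 : ℝ) : ℂ) ≠ 0 := by exact_mod_cast (one_sub_norm_sq_pos hl).ne'
  have hc : conj l * l = (‖l‖ : ℂ) ^ 2 := Complex.conj_mul' l
  have h1 := one_add_conj_mul_discAut hl hz
  have h2 : discAut (-l) (discAut l z) = (discAut l z + l) / (1 + conj l * discAut l z) := by
    rw [discAut]; simp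
  rw [h2, h1, div_eq_iff (div_ne_zero hd h), discAut]
  rw [div_add' _ _ _ h, ← mul_div_assoc, div_left_inj' h]
  push_cast
  linear_combination -z * hc

theorem discAut_discAut_neg (hl : ‖l‖ < 1) (hz : ‖z‖ ≤ 1) : discAut l (discAut (-l) z) = z := by
  have := discAut_neg_discAut (l := -l) (by simpa using hl) hz
  rwa [neg_neg] at this

theorem differentiableAt_discAut (hl : ‖l‖ < 1) (hz : ‖z‖ ≤ 1) :
    DifferentiableAt ℂ (discAut l) z := by
  unfold discAut
  exact DifferentiableAt.div (by fun_prop) (by fun_prop) (one_sub_conj_mul_ne_zero hl hz)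

theorem analyticAt_discAut (hl : ‖l‖ < 1) (hz : ‖z‖ ≤ 1) : AnalyticAt ℂ (discAut l) z := by
  unfold discAut
  exact AnalyticAt.div (by fun_prop) (by fun_prop) (one_sub_conj_mul_ne_zero hl hz)

end discAut

/-! ### Interpolation with uniform bounds -/

/-- Among `N + 2` adjacent intervals of equal length one contains none of `N + 1` given numbers. -/
theorem exists_gap {N : ℕ} (x : Fin (N + 1) → ℝ) {g : ℝ} (hg : 0 ≤ g) :
    ∃ i : ℕ, i ≤ N + 1 ∧ ∀ k, x k ≤ (i + 1) * g ∨ (i + 1) * g + g ≤ x k := by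
  by_contra! h
  choose k hk using fun i : Fin (N + 2) => h i (by omega)
  obtain ⟨i, j, hij, hkij⟩ := Fintype.exists_ne_map_eq_of_card_lt k (by simp)
  wlog hlt : i < j generalizing i j
  · exact this j i hij.symm hkij.symm (lt_of_le_of_ne (not_lt.1 hlt) hij.symm)
  have h1 := (hk i).2
  have h2 := (hk j).1
  rw [← hkij] at h2
  have h3 : ((i : ℕ) : ℝ) + 1 ≤ (j : ℕ) := by exact_mod_cast hlt
  nlinarith

open ComplexConjugate in
/-- Interpolation in the disc with bounds that do not depend on the position of the points. -/
theorem exists_interpolant (N m : ℕ) :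
    ∃ C : ℝ, 0 ≤ C ∧ ∀ l : Fin (N + 1) → ℂ, (∀ k, ‖l k‖ < 1) → ∀ J : Fin (N + 1),
      ∃ f : ℂ → ℂ, DifferentiableOn ℂ f (ball 0 1) ∧
        (∀ z ∈ ball (0 : ℂ) 1,
          ‖f z‖ ≤ C * ((1 - ‖l J‖ ^ 2) / ‖1 - conj (l J) * z‖) ^ m) ∧
        iteratedDeriv J f (l J) = (((1 - ‖l J‖ ^ 2) ^ (J : ℕ))⁻¹ : ℝ) ∧
        ∀ k, k ≠ J → iteratedDeriv k f (l k) = 0 := by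
  -- The N + 2 candidate gaps fill the interval from g to 1 - g, so the chosen one stays at distance
  -- g from the unit circle.
  set g : ℝ := 1 / (N + 4) with hgdef
  have hN4 : (0 : ℝ) < N + 4 := by positivity
  have hg : 0 < g := by positivity
  have hgN : (N + 4) * g = 1 := by rw [hgdef]; field_simp
  have hg1 : g ≤ 1 := by nlinarith [(Nat.cast_nonneg N : (0 : ℝ) ≤ N)]
  -- Half the gap: the circle of radius r + δ keeps distance δ from near and far points alike.
  set δ : ℝ := g / 2 with hδdef
  have hδ : 0 < δ := by positivity
  have hδ1 : δ ≤ 1 := by linarith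
  obtain ⟨D, hD, hherm⟩ := exists_hermite_interpolation hδ ((N + 1) * (N + 1))
  set M : ℝ := (2 / δ) ^ N / (δ ^ m * (δ ^ (N + 1)) ^ (N + 1)) with hMdef
  have hM : 0 ≤ M := by positivity
  refine ⟨((2 : ℝ) ^ (N + 1)) ^ (N + 1) * (D * M), by positivity, fun l hl J => ?_⟩
  set a := l J with ha
  have hla : ‖a‖ < 1 := hl J
  set d : ℝ := 1 - ‖a‖ ^ 2 with hd
  have hd0 : 0 < d := one_sub_norm_sq_pos hla
  set x : Fin (N + 1) → ℂ := fun k => discAut a (l k) with hx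
  have hx1 : ∀ k, ‖x k‖ < 1 := fun k => norm_discAut_lt_one hla (hl k)
  have hxJ : x J = 0 := discAut_self
  obtain ⟨i, hi, hgap⟩ := exists_gap (fun k => ‖x k‖) hg.le
  set r : ℝ := (i + 1) * g with hr
  have hi' : (i : ℝ) ≤ N + 1 := by exact_mod_cast hi
  have hr0 : 0 < r := by positivity
  have hr1 : r + g + g ≤ 1 := by nlinarith
  set r' : ℝ := r + δ with hr'
  have hr'1 : r' ≤ 1 - δ := by linarith
  have hball : ∀ w ∈ ball (0 : ℂ) r', ‖w‖ ≤ 1 - δ := fun w hw => by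
    rw [mem_ball_zero_iff] at hw; linarith
  -- the denominator
  have hden : ∀ w : ℂ, ‖w‖ ≤ 1 - δ → δ ≤ ‖1 + conj a * w‖ := fun w hw => by
    have h1 : ‖conj a * w‖ ≤ 1 - δ := by
      rw [norm_mul, RCLike.norm_conj]
      nlinarith [norm_nonneg a, norm_nonneg w]
    have h2 := norm_sub_norm_le (1 : ℂ) (-(conj a * w))
    rw [norm_neg, norm_one, sub_neg_eq_add] at h2
    linarith
  have hclose : ∀ w : ℂ, ‖w‖ ≤ 1 - δ → discAut (-a) w ∈ closedBall a (d / δ) := fun w hw => by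
    rw [mem_closedBall, dist_eq_norm, discAut_neg_sub hla (by linarith), norm_div, norm_mul,
      Complex.norm_real, Real.norm_of_nonneg hd0.le]
    refine div_le_div₀ hd0.le ?_ hδ (hden w hw)
    nlinarith
  -- the factor vanishing at the far points
  set F : Fin (N + 1) → ℂ → ℂ := fun k w => if ‖x k‖ ≤ r then 1 else (w - x k) ^ (N + 1) with hF
  have hFd : ∀ k, Differentiable ℂ (F k) := fun k => by
    by_cases h : ‖x k‖ ≤ r
    · simp [hF, h]
    · simp only [hF, h, if_false]; fun_prop
  set A : ℂ → ℂ := fun w => ∏ k, F k w with hA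
  have hAd : Differentiable ℂ A := Differentiable.fun_finsetProd fun k _ => hFd k
  have hAle : ∀ w ∈ ball (0 : ℂ) 1, ‖A w‖ ≤ ((2 : ℝ) ^ (N + 1)) ^ (N + 1) := fun w hw => by
    rw [mem_ball_zero_iff] at hw
    calc ‖A w‖ = ∏ k, ‖F k w‖ := norm_prod _ _
      _ ≤ ∏ _k : Fin (N + 1), (2 : ℝ) ^ (N + 1) := by
          refine Finset.prod_le_prod (fun _ _ => norm_nonneg _) fun k _ => ?_
          by_cases h : ‖x k‖ ≤ r
          · simp only [hF, h, if_true, norm_one]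
            exact one_le_pow₀ one_le_two
          · simp only [hF, h, if_false, norm_pow]
            gcongr
            exact (norm_sub_le _ _).trans (by linarith [hx1 k])
      _ = _ := by simp
  have hAge : ∀ w ∈ ball (0 : ℂ) r', (δ ^ (N + 1)) ^ (N + 1) ≤ ‖A w‖ := fun w hw => by
    rw [mem_ball_zero_iff] at hw
    calc (δ ^ (N + 1)) ^ (N + 1) = ∏ _k : Fin (N + 1), δ ^ (N + 1) := by simp
      _ ≤ ∏ k, ‖F k w‖ := by
          refine Finset.prod_le_prod (fun _ _ => by positivity) fun k _ => ?_
          by_cases h : ‖x k‖ ≤ r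
          · simp only [hF, h, if_true, norm_one]
            exact pow_le_one₀ hδ.le hδ1
          · simp only [hF, h, if_false, norm_pow]
            have h1 := (hgap k).resolve_left h
            have h2 := norm_sub_norm_le (x k) w
            rw [norm_sub_rev] at h2
            gcongr
            linarith
      _ = _ := (norm_prod _ _).symm
  -- the target function
  set v : ℕ → ℂ := fun k => if h : k < N + 1 then (if ‖x ⟨k, h⟩‖ ≤ r then l ⟨k, h⟩ else a) else a
    with hv
  have hρ : 0 ≤ d / δ := by positivity
  obtain ⟨P, hP1, hP2, hP3⟩ := exists_abelGontscharoff a hρ J v fun k => by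
    simp only [hv]
    split_ifs with h1 h2
    · have := hclose (x ⟨k, h1⟩) (by linarith)
      rwa [hx, discAut_neg_discAut hla (hl _).le] at this
    · exact mem_closedBall_self hρ
    · exact mem_closedBall_self hρ
  set T : ℂ → ℂ := fun z => (((d ^ (J : ℕ))⁻¹ : ℝ) : ℂ) * P.eval z with hT
  have hPd : Differentiable ℂ fun z => P.eval z := P.differentiable
  have hTd : Differentiable ℂ T := by fun_prop
  have hTle : ∀ w : ℂ, ‖w‖ ≤ 1 - δ → ‖T (discAut (-a) w)‖ ≤ (2 / δ) ^ N := fun w hw => by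
    simp only [hT]
    rw [norm_mul, Complex.norm_real, Real.norm_of_nonneg (by positivity)]
    calc (d ^ (J : ℕ))⁻¹ * ‖P.eval (discAut (-a) w)‖
        ≤ (d ^ (J : ℕ))⁻¹ * (2 * (d / δ)) ^ (J : ℕ) := by
          gcongr
          exact hP3 _ (hclose w hw)
      _ = (2 / δ) ^ (J : ℕ) := by
          rw [← inv_pow, ← mul_pow]
          congr 1
          field_simp
      _ ≤ (2 / δ) ^ N := by
          apply pow_le_pow_right₀ _ (by omega)
          rw [le_div_iff₀ hδ]; linarith
  set Φ : ℂ → ℂ := fun w => T (discAut (-a) w) / ((1 + conj a * w) ^ m * A w) with hΦ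
  have hne : ∀ w ∈ ball (0 : ℂ) r', (1 + conj a * w) ^ m * A w ≠ 0 := fun w hw => by
    refine mul_ne_zero (pow_ne_zero _ ?_) ?_
    · exact norm_pos_iff.1 (hδ.trans_le (hden w (hball w hw)))
    · exact norm_pos_iff.1 (lt_of_lt_of_le (by positivity) (hAge w hw))
  have hΦd : DifferentiableOn ℂ Φ (ball 0 r') := fun w hw => by
    have h1 : DifferentiableAt ℂ (discAut (-a)) w :=
      differentiableAt_discAut (by simpa using hla) (by linarith [hball w hw])
    refine DifferentiableAt.differentiableWithinAt (DifferentiableAt.fun_div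
      (hTd.differentiableAt.comp w h1) (DifferentiableAt.fun_mul ?_ hAd.differentiableAt)
      (hne w hw))
    fun_prop
  have hΦle : ∀ w ∈ ball (0 : ℂ) r', ‖Φ w‖ ≤ M := fun w hw => by
    change ‖T (discAut (-a) w) / ((1 + conj a * w) ^ m * A w)‖ ≤ M
    rw [norm_div, norm_mul ((1 + conj a * w) ^ m), norm_pow]
    have h1 := hden w (hball w hw)
    have h2 := hAge w hw
    have h3 := hTle w (hball w hw)
    rw [hMdef]
    gcongr
  -- Padding with 0 fixes the number of nodes at (N + 1)², so that D depends on N only; the extra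
  -- conditions at 0 are harmless.
  set y : Fin (N + 1) → ℂ := fun k => if ‖x k‖ ≤ r then x k else 0 with hy
  obtain ⟨Q, R, hQ, hQle, hR, hQR⟩ := hherm r r' (by linarith) le_rfl
    ((N + 1) • (Finset.univ.val.map y)) (by simp) (fun ζ hζ => by
      have := Multiset.mem_of_mem_nsmul hζ
      simp only [Multiset.mem_map] at this
      obtain ⟨k, -, rfl⟩ := this
      simp only [hy]
      split_ifs with h
      · exact h
      · simpa using hr0.le) Φ M hΦd hΦle
  have hQR' : ∀ w ∈ ball (0 : ℂ) r', Φ w = Q w + (∏ k, (w - y k)) ^ (N + 1) * R w :=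
    fun w hw => by
      rw [hQR w hw, Multiset.map_nsmul, Multiset.prod_nsmul, Multiset.map_map]; rfl
  -- the interpolant
  set f : ℂ → ℂ := fun z =>
    (1 + conj a * discAut a z) ^ m * A (discAut a z) * Q (discAut a z) with hf
  have hfd : DifferentiableOn ℂ f (ball 0 1) := fun z hz => by
    have h1 : DifferentiableAt ℂ (discAut a) z :=
      differentiableAt_discAut hla (mem_ball_zero_iff.1 hz).le
    have h2 : DifferentiableAt ℂ (fun z => A (discAut a z)) z := hAd.differentiableAt.comp z h1
    have h3 : DifferentiableAt ℂ (fun z => Q (discAut a z)) z := hQ.differentiableAt.comp z h1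
    exact DifferentiableAt.differentiableWithinAt (by fun_prop)
  have hpsi : ∀ k, AnalyticAt ℂ (discAut a) (l k) := fun k => analyticAt_discAut hla (hl k).le
  have hQan : ∀ k, AnalyticAt ℂ (fun z => Q (discAut a z)) (l k) := fun k =>
    (hQ.analyticAt _).comp (hpsi k)
  have hfan : ∀ k, AnalyticAt ℂ f (l k) := fun k =>
    hfd.analyticAt (isOpen_ball.mem_nhds (mem_ball_zero_iff.2 (hl k)))
  have hnear : ∀ k, ‖x k‖ ≤ r →
      iteratedDeriv k f (l k) = iteratedDeriv k T (l k) := fun k hk => by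
    have hxk : x k ∈ ball (0 : ℂ) r' := by rw [mem_ball_zero_iff]; linarith
    have hR' : AnalyticAt ℂ (fun z => R (discAut a z)) (l k) :=
      AnalyticAt.comp (g := R) (hR.analyticAt (isOpen_ball.mem_nhds hxk)) (hpsi k)
    -- Multiplying the Hermite remainder back shows that f - T contains the (N + 1)-st power of a
    -- function vanishing at `l k`.
    have h0 : iteratedDeriv k (f - T) (l k) = 0 := by
      refine iteratedDeriv_eq_zero_of_eventuallyEq_pow_mul (n := N + 1)
        (g := fun z => ∏ k, (discAut a z - y k))
        (h := fun z => -((1 + conj a * discAut a z) ^ m * A (discAut a z) * R (discAut a z)))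
        k.2 ?_ ?_ ?_ ?_
      · have := hpsi k
        exact Finset.analyticAt_fun_prod _ fun j _ => by fun_prop
      · exact Finset.prod_eq_zero (Finset.mem_univ k) (sub_eq_zero.2 (if_pos hk).symm)
      · have := hpsi k
        have h2 : AnalyticAt ℂ (fun z => A (discAut a z)) (l k) :=
          (hAd.analyticAt _).comp (hpsi k)
        refine AnalyticAt.fun_neg (AnalyticAt.fun_mul (AnalyticAt.fun_mul ?_ h2) hR')
        fun_prop
      · have e1 : ∀ᶠ z in 𝓝 (l k), discAut a z ∈ ball (0 : ℂ) r' :=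
          (hpsi k).continuousAt.eventually (isOpen_ball.mem_nhds hxk)
        have e2 : ∀ᶠ z in 𝓝 (l k), z ∈ ball (0 : ℂ) 1 :=
          isOpen_ball.mem_nhds (mem_ball_zero_iff.2 (hl k))
        filter_upwards [e1, e2] with z hz1 hz2
        have h1 := hQR' _ hz1
        have h2 := hne _ hz1
        simp only [hΦ] at h1
        rw [discAut_neg_discAut hla (mem_ball_zero_iff.1 hz2).le, div_eq_iff h2] at h1
        simp only [Pi.sub_apply, hf]
        rw [h1]
        ring
    rw [iteratedDeriv_sub (hfan k).contDiffAt hTd.contDiff.contDiffAt, sub_eq_zero] at h0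
    exact h0
  have hTder : ∀ (k : ℕ) (z : ℂ), iteratedDeriv k T z =
      (((d ^ (J : ℕ))⁻¹ : ℝ) : ℂ) * iteratedDeriv k (fun z => P.eval z) z := fun k z =>
    iteratedDeriv_const_mul_field _ _
  refine ⟨f, hfd, fun z hz => ?_, ?_, fun k hkJ => ?_⟩
  · have hz1 := mem_ball_zero_iff.1 hz
    have hw : discAut a z ∈ ball (0 : ℂ) 1 := mem_ball_zero_iff.2 (norm_discAut_lt_one hla hz1)
    simp only [hf]
    rw [one_add_conj_mul_discAut hla hz1.le, norm_mul, norm_mul, norm_pow, norm_div,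
      Complex.norm_real, Real.norm_of_nonneg hd0.le]
    have h1 := hAle _ hw
    have h2 := hQle _ hw
    calc _ ≤ (d / ‖1 - conj a * z‖) ^ m * ((2 : ℝ) ^ (N + 1)) ^ (N + 1) * (D * M) := by gcongr
      _ = _ := by ring
  · rw [hnear J (by simp [hxJ, hr0.le]), hTder, hP1, mul_one]
  · by_cases hk : ‖x k‖ ≤ r
    · rw [hnear k hk, hTder]
      rcases lt_or_gt_of_ne (fun h => hkJ (Fin.ext h) : (k : ℕ) ≠ J) with h | h
      · have := hP2 k h
        simp only [hv, k.2, dif_pos, Fin.eta, hk, if_true] at this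
        rw [this, mul_zero]
      · obtain ⟨n, hn⟩ := Nat.exists_eq_add_of_lt h
        -- For k > J no node condition is needed: the J-th derivative of P is constant.
        have : iteratedDeriv (k : ℕ) (fun z => P.eval z) = 0 := by
          rw [hn, iteratedDeriv_eq_iterate, show (J : ℕ) + n + 1 = (n + 1) + J by ring,
            Function.iterate_add_apply, ← iteratedDeriv_eq_iterate (n := (J : ℕ)),
            show iteratedDeriv (J : ℕ) (fun z => P.eval z) = fun _ => 1 from funext hP1,
            ← iteratedDeriv_eq_iterate]
          ext z
          simp [iteratedDeriv_const]
        rw [this]; simp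
    · refine iteratedDeriv_eq_zero_of_eventuallyEq_pow_mul (n := N + 1)
        (g := fun z => discAut a z - x k)
        (h := fun z => (1 + conj a * discAut a z) ^ m *
          (∏ j ∈ Finset.univ.erase k, F j (discAut a z)) * Q (discAut a z)) k.2 ?_ ?_ ?_ ?_
      · have := hpsi k
        fun_prop
      · simp [hx]
      · have h1 := hpsi k
        have h2 := hQan k
        have h3 : AnalyticAt ℂ (fun z => ∏ j ∈ Finset.univ.erase k, F j (discAut a z)) (l k) :=
          Finset.analyticAt_fun_prod _ fun j _ => ((hFd j).analyticAt _).comp (hpsi k)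
        refine AnalyticAt.fun_mul (AnalyticAt.fun_mul ?_ h3) h2
        fun_prop
      · refine Eventually.of_forall fun z => ?_
        have hAk : A (discAut a z) = (discAut a z - x k) ^ (N + 1) *
            ∏ j ∈ Finset.univ.erase k, F j (discAut a z) := by
          simp only [hA]
          rw [← Finset.mul_prod_erase _ _ (Finset.mem_univ k)]
          congr 1
          simp only [hF, hk, if_false]
        simp only [hf, hAk]
        ring

/-! ### Uniform norm estimates for kernels -/

section kernel

open ComplexConjugate

variable {a z w : ℂ}

theorem half_one_sub_norm_sq_le (ha : ‖a‖ < 1) (hz : ‖z‖ ≤ 1) :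
    (1 - ‖a‖ ^ 2) / 2 ≤ ‖1 - conj a * z‖ := by
  have h1 : ‖conj a * z‖ ≤ ‖a‖ := by
    rw [norm_mul, RCLike.norm_conj]
    nlinarith [norm_nonneg a]
  have h2 := norm_sub_norm_le (1 : ℂ) (conj a * z)
  rw [norm_one] at h2
  nlinarith [norm_nonneg a]

theorem hasDerivAt_discAut_neg (ha : ‖a‖ < 1) (hw : ‖w‖ ≤ 1) :
    HasDerivAt (discAut (-a)) (((1 - ‖a‖ ^ 2 : ℝ) : ℂ) / (1 + conj a * w) ^ 2) w := by
  have hc : conj a * a = (‖a‖ : ℂ) ^ 2 := Complex.conj_mul' a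
  have h := one_add_conj_mul_ne_zero ha hw
  have h1 : HasDerivAt (fun z => z + a) 1 w := (hasDerivAt_id w).add_const a
  have h2 : HasDerivAt (fun z => 1 + conj a * z) (conj a) w := by
    simpa using ((hasDerivAt_id w).const_mul (conj a)).const_add 1
  have h3 := h1.fun_div h2 h
  have h4 : discAut (-a) = fun z => (z + a) / (1 + conj a * z) := by
    ext z; simp [discAut]
  rw [h4]
  refine h3.congr_deriv ?_
  congr 1
  push_cast
  linear_combination -hc

theorem image_discAut_neg_ball (ha : ‖a‖ < 1) :
    discAut (-a) '' ball (0 : ℂ) 1 = ball (0 : ℂ) 1 := by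
  have ha' : ‖-a‖ < 1 := by simpa using ha
  ext z
  simp only [Set.mem_image, mem_ball_zero_iff]
  constructor
  · rintro ⟨w, hw, rfl⟩
    exact norm_discAut_lt_one ha' hw
  · exact fun hz => ⟨discAut a z, norm_discAut_lt_one ha hz, discAut_neg_discAut ha hz.le⟩

theorem abs_det_restrictScalars_toSpanSingleton (c : ℂ) :
    |((ContinuousLinearMap.toSpanSingleton ℂ c).restrictScalars ℝ).det| = ‖c‖ ^ 2 := by
  simp [ContinuousLinearMap.det, LinearMap.det_restrictScalars,
    Algebra.norm_complex_eq, Complex.normSq_eq_norm_sq]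

/-- A Forelli–Rudin estimate, uniform in the parameter. -/
theorem lintegral_ball_kernel_le (ha : ‖a‖ < 1) {α t : ℝ} (ht : 2 * (2 + α) ≤ t) :
    ∫⁻ z in ball (0 : ℂ) 1, ENNReal.ofReal ((1 - ‖a‖ ^ 2) ^ (t - (2 + α)) *
        (1 - ‖z‖ ^ 2) ^ α * ‖1 - conj a * z‖ ^ (-t)) ≤
      ∫⁻ z in ball (0 : ℂ) 1, ENNReal.ofReal ((2 : ℝ) ^ (t - 2 * (2 + α)) * (1 - ‖z‖ ^ 2) ^ α) := by
  have ha' : ‖-a‖ < 1 := by simpa using ha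
  -- Substitute z = `discAut (-a) w`, with Jacobian d² / |1 + conj a * w|⁴.
  conv_lhs => rw [← image_discAut_neg_ball ha]
  rw [lintegral_image_eq_lintegral_abs_det_fderiv_mul volume measurableSet_ball
    (f' := fun w => (ContinuousLinearMap.toSpanSingleton ℂ
      (((1 - ‖a‖ ^ 2 : ℝ) : ℂ) / (1 + conj a * w) ^ 2)).restrictScalars ℝ)
    (fun w hw => ((hasDerivAt_discAut_neg ha
      (mem_ball_zero_iff.1 hw).le).hasFDerivAt.restrictScalars ℝ).hasFDerivWithinAt)
    (Set.LeftInvOn.injOn (f₁' := discAut a)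
      fun w hw => discAut_discAut_neg ha (mem_ball_zero_iff.1 hw).le)]
  refine setLIntegral_mono' measurableSet_ball fun w hw => ?_
  have hw1 := mem_ball_zero_iff.1 hw
  rw [abs_det_restrictScalars_toSpanSingleton, ← ENNReal.ofReal_mul (by positivity)]
  refine ENNReal.ofReal_le_ofReal ?_
  have e1 := one_sub_norm_sq_discAut ha' hw1.le
  have e2 := one_add_conj_mul_discAut ha' hw1.le
  simp only [map_neg, neg_mul, sub_neg_eq_add, ← sub_eq_add_neg, norm_neg] at e1 e2
  have hu := one_sub_norm_sq_pos hw1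
  have hd := one_sub_norm_sq_pos ha
  have he : 0 < ‖1 + conj a * w‖ := norm_pos_iff.2 (one_add_conj_mul_ne_zero ha hw1.le)
  have he2 : ‖1 + conj a * w‖ ≤ 2 := by
    refine (norm_add_le _ _).trans ?_
    rw [norm_one]
    linarith [norm_conj_mul_lt_one ha hw1.le]
  rw [e1, e2, norm_div, norm_div, Complex.norm_real, Real.norm_of_nonneg hd.le, norm_pow]
  set d := 1 - ‖a‖ ^ 2
  set u := 1 - ‖w‖ ^ 2
  set e := ‖1 + conj a * w‖
  -- All powers of d cancel. What remains is a nonnegative power of e ≤ 2, by `ht`.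
  have key : (d / e ^ 2) ^ 2 * (d ^ (t - (2 + α)) * (d * u / e ^ 2) ^ α * (d / e) ^ (-t)) =
      e ^ (t - 2 * (2 + α)) * u ^ α := by
    rw [Real.div_rpow (by positivity) (by positivity), Real.div_rpow hd.le he.le,
      Real.mul_rpow hd.le hu.le, Real.rpow_neg hd.le, Real.rpow_neg he.le, Real.rpow_sub hd,
      Real.rpow_add hd, Real.rpow_sub he, mul_add, Real.rpow_add he, ← Real.rpow_natCast e 2,
      ← Real.rpow_mul he.le]
    have h4 : e ^ (2 * 2 : ℝ) = e ^ 4 := by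
      rw [← Real.rpow_natCast]; norm_num
    have h2 : d ^ (2 : ℝ) = d ^ 2 := Real.rpow_two d
    have h3 : e ^ ((2 : ℕ) : ℝ) = e ^ 2 := Real.rpow_natCast e 2
    rw [h4, h2, h3, Nat.cast_ofNat]
    have p1 := Real.rpow_pos_of_pos hd α
    have p2 := Real.rpow_pos_of_pos hd t
    have p3 := Real.rpow_pos_of_pos he t
    have p4 := Real.rpow_pos_of_pos he (2 * α)
    field_simp
  rw [key]
  have := Real.rpow_le_rpow he.le he2 (sub_nonneg.2 ht)
  have := Real.rpow_nonneg hu.le α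
  gcongr

/-- In polar coordinates (1 + y)^α is bounded for either sign of α, which leaves the integrable (1 -
y)^α. -/
theorem integrableOn_one_sub_norm_sq_rpow {α : ℝ} (hα : -1 < α) :
    IntegrableOn (fun z : ℂ => (1 - ‖z‖ ^ 2) ^ α) (ball 0 1) := by
  refine (integrableOn_fun_norm_addHaar volume (f := fun y : ℝ => (1 - y ^ 2) ^ α)).2 ?_
  have h1 : IntegrableOn (fun y : ℝ => (1 - y) ^ α) (Set.Ioo 0 1) := by
    have h := (intervalIntegral.intervalIntegrable_rpow' (a := 0) (b := 1) hα).comp_sub_left 1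
    rw [sub_zero, sub_self] at h
    rw [← integrableOn_Ioc_iff_integrableOn_Ioo,
      ← intervalIntegrable_iff_integrableOn_Ioc_of_le zero_le_one]
    exact h.symm
  have h2 : IntegrableOn (fun _ : ℝ => (2 : ℝ) ^ α + 1) (Set.Ioo 0 1) :=
    integrableOn_const (by simp)
  refine Integrable.mono' ((h1.const_mul ((2 : ℝ) ^ α + 1))) (by fun_prop) ?_
  filter_upwards [ae_restrict_mem measurableSet_Ioo] with y hy
  have hp : 0 < 1 - y := sub_pos.2 hy.2
  have hp' : 0 < 1 + y := by linarith [hy.1]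
  have h3 : (1 - y ^ 2) ^ α = (1 + y) ^ α * (1 - y) ^ α := by
    rw [← Real.mul_rpow hp'.le hp.le]; ring_nf
  have h4 : (1 + y) ^ α ≤ 2 ^ α + 1 := by
    rcases le_total 0 α with h | h
    · have := Real.rpow_le_rpow hp'.le (by linarith [hy.2] : 1 + y ≤ 2) h
      linarith
    · have := Real.rpow_le_one_of_one_le_of_nonpos (by linarith [hy.1] : 1 ≤ 1 + y) h
      have := Real.rpow_nonneg zero_le_two α
      linarith
  have p1 := Real.rpow_nonneg hp'.le α
  have p2 := Real.rpow_nonneg hp.le α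
  rw [Complex.finrank_real_complex, h3, smul_eq_mul, Real.norm_of_nonneg (by have := hy.1; positivity)]
  calc y ^ (2 - 1) * ((1 + y) ^ α * (1 - y) ^ α) ≤ 1 * ((2 ^ α + 1) * (1 - y) ^ α) := by
        gcongr
        simpa using hy.2.le
    _ = _ := one_mul _

/-- The Poisson kernel has mean one on the unit circle. -/
theorem lintegral_circle_kernel (ha : ‖a‖ < 1) :
    ∫⁻ θ in Set.Ioc 0 (2 * Real.pi), ENNReal.ofReal ((1 - ‖a‖ ^ 2) *
      (‖1 - conj a * circleMap 0 1 θ‖ ^ 2)⁻¹) = ENNReal.ofReal (2 * Real.pi) := by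
  have hpi := Real.two_pi_pos
  have hd := one_sub_norm_sq_pos ha
  have hcm : ∀ θ, ‖circleMap 0 1 θ‖ = 1 := fun θ => by simp
  have hker : ∀ θ, (1 - ‖a‖ ^ 2) * (‖1 - conj a * circleMap 0 1 θ‖ ^ 2)⁻¹ =
      poissonKernel 0 a (circleMap 0 1 θ) := fun θ => by
    have : ‖1 - conj a * circleMap 0 1 θ‖ = ‖circleMap 0 1 θ - a‖ := by
      have h1 : (1 : ℂ) = conj (circleMap 0 1 θ) * circleMap 0 1 θ := by
        rw [Complex.conj_mul', hcm]; simp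
      calc _ = ‖conj (circleMap 0 1 θ - a) * circleMap 0 1 θ‖ := by
            rw [map_sub, sub_mul, ← h1]
        _ = _ := by rw [norm_mul, RCLike.norm_conj, hcm, mul_one]
    rw [this, poissonKernel_def]
    simp [div_eq_mul_inv]
  have hint : ∫ θ in (0 : ℝ)..2 * Real.pi, (1 - ‖a‖ ^ 2) *
      (‖1 - conj a * circleMap 0 1 θ‖ ^ 2)⁻¹ = 2 * Real.pi := by
    have h := InnerProductSpace.HarmonicOnNhd.circleAverage_poissonKernel_smul
      (f := fun _ : ℂ => (1 : ℝ)) (c := 0) (R := 1) (w := a)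
      (fun z _ => InnerProductSpace.harmonicAt_const 1) (by simpa using ha)
    rw [Real.circleAverage_def, smul_eq_mul, inv_mul_eq_iff_eq_mul₀ hpi.ne', mul_one] at h
    simp_rw [hker]
    simpa using h
  have h0 := ofReal_integral_eq_lintegral_ofReal (μ := volume.restrict (Set.Ioc 0 (2 * Real.pi)))
    (f := fun θ => (1 - ‖a‖ ^ 2) * (‖1 - conj a * circleMap 0 1 θ‖ ^ 2)⁻¹) ?_
    (Eventually.of_forall fun θ => by change (0 : ℝ) ≤ _; positivity)
  · rw [← h0, ← intervalIntegral.integral_of_le hpi.le, hint]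
  · refine Continuous.integrableOn_Ioc ?_
    refine continuous_const.mul (Continuous.inv₀ (by fun_prop) fun θ => ?_)
    exact pow_ne_zero _ (norm_ne_zero_iff.2 (one_sub_conj_mul_ne_zero ha (hcm θ).le))

end kernel

open ComplexConjugate in
/-- The kernels `(1 - |a|²) ^ (m - s) / |1 - conj a * z| ^ m`, with `s = (2 + α) / p`, are bounded
in `A^p_α` uniformly in `a`. -/
theorem exists_bergmanNorm_le_of_le_kernel {p : ℝ≥0∞} (hp : 0 < p) {α : ℝ} (hα : -1 ≤ α) {m : ℕ}
    (hm : 2 * ((2 + α) * (p⁻¹).toReal) ≤ m) :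
    ∃ B : ℝ≥0, ∀ a : ℂ, ‖a‖ < 1 → ∀ (f : ℂ → ℂ) (c : ℝ), 0 ≤ c →
      (∀ z ∈ ball (0 : ℂ) 1, ‖f z‖ ≤ c * ((1 - ‖a‖ ^ 2) ^ ((m : ℝ) - (2 + α) * (p⁻¹).toReal) /
        ‖1 - conj a * z‖ ^ m)) →
      bergmanNorm p α f ≤ ENNReal.ofReal c * B := by
  by_cases hpt : p = ∞
  · subst hpt
    refine ⟨2 ^ m, fun a ha f c hc hf => ?_⟩
    simp only [bergmanNorm, if_true]
    refine iSup₂_le fun z hz => ?_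
    have hd := one_sub_norm_sq_pos ha
    have h1 := half_one_sub_norm_sq_le ha (mem_ball_zero_iff.1 hz).le
    have h0 : 0 < ‖1 - conj a * z‖ := by linarith
    have h2 := hf z hz
    rw [ENNReal.inv_top, ENNReal.toReal_zero, mul_zero, sub_zero, Real.rpow_natCast, ← div_pow] at h2
    have h3 : ‖f z‖ ≤ c * 2 ^ m := h2.trans (by
      gcongr
      rw [div_le_iff₀ h0]; linarith)
    rw [← ofReal_norm, show ((2 ^ m : ℝ≥0) : ℝ≥0∞) = ENNReal.ofReal (2 ^ m) by
      rw [ENNReal.ofReal_pow zero_le_two]; simp, ← ENNReal.ofReal_mul hc]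
    exact ENNReal.ofReal_le_ofReal h3
  set P := p.toReal with hP
  have hP0 : 0 < P := ENNReal.toReal_pos hp.ne' hpt
  rw [ENNReal.toReal_inv, ← hP] at hm ⊢
  have ht : 2 * (2 + α) ≤ m * P := by
    have := mul_le_mul_of_nonneg_right hm hP0.le
    rwa [mul_assoc, mul_assoc, inv_mul_cancel₀ hP0.ne', mul_one] at this
  set k : ℂ → ℂ → ℝ := fun a z =>
    (1 - ‖a‖ ^ 2) ^ ((m : ℝ) - (2 + α) * P⁻¹) / ‖1 - conj a * z‖ ^ m with hk
  have hk0 : ∀ a, ‖a‖ < 1 → ∀ z, 0 ≤ k a z := fun a ha z => by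
    have := one_sub_norm_sq_pos ha
    simp only [hk]
    positivity
  have hkP : ∀ a, ‖a‖ < 1 → ∀ z, ‖k a z‖ₑ ^ P =
      ENNReal.ofReal ((1 - ‖a‖ ^ 2) ^ (m * P - (2 + α)) * ‖1 - conj a * z‖ ^ (-(m * P))) :=
    fun a ha z => by
      have hd := one_sub_norm_sq_pos ha
      rw [Real.enorm_of_nonneg (hk0 a ha z), ENNReal.ofReal_rpow_of_nonneg (hk0 a ha z) hP0.le]
      congr 1
      simp only [hk]
      rw [Real.div_rpow (by positivity) (by positivity), ← Real.rpow_mul hd.le, sub_mul, mul_assoc,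
        inv_mul_cancel₀ hP0.ne', mul_one, ← Real.rpow_natCast_mul (norm_nonneg _),
        Real.rpow_neg (norm_nonneg _), div_eq_mul_inv]
  by_cases hα1 : α = -1
  · subst hα1
    set b : ℝ := 2 ^ (m * P - 2) with hb
    have hb0 : 0 ≤ b := by positivity
    refine ⟨(b ^ P⁻¹).toNNReal, fun a ha f c hc hf => ?_⟩
    simp only [bergmanNorm, hpt, if_false, if_true, hardyNorm]
    refine iSup₂_le fun r hr => ?_
    set μ := (ENNReal.ofReal (2 * Real.pi))⁻¹ • volume.restrict (Set.Ioc 0 (2 * Real.pi))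
    have hcm : ∀ θ, ‖circleMap 0 r θ‖ = r := fun θ => by simp [abs_of_pos hr.1]
    have h1 : ∀ θ, ‖f (circleMap 0 r θ)‖ ≤ c * ‖k a (circleMap 0 r θ)‖ := fun θ => by
      rw [Real.norm_of_nonneg (hk0 a ha _)]
      exact hf _ (by rw [mem_ball_zero_iff, hcm]; exact hr.2)
    refine (eLpNorm_le_mul_eLpNorm_of_ae_le_mul (Eventually.of_forall h1) p).trans ?_
    gcongr
    have hd := one_sub_norm_sq_pos ha
    -- Moving the radius r into the parameter reduces to the Poisson kernel on the unit circle.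
    set a' : ℂ := r * a with ha'
    have ha'a : ‖a'‖ ≤ ‖a‖ := by
      rw [ha', norm_mul, Complex.norm_real, Real.norm_of_nonneg hr.1.le]
      exact mul_le_of_le_one_left (norm_nonneg _) hr.2.le
    have ha'1 : ‖a'‖ < 1 := ha'a.trans_lt ha
    have hle : ∀ θ, ‖k a (circleMap 0 r θ)‖ₑ ^ P ≤ ENNReal.ofReal b *
        ENNReal.ofReal ((1 - ‖a'‖ ^ 2) * (‖1 - conj a' * circleMap 0 1 θ‖ ^ 2)⁻¹) := fun θ => by
      rw [hkP a ha, ← ENNReal.ofReal_mul hb0]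
      refine ENNReal.ofReal_le_ofReal ?_
      have e1 : conj a * circleMap 0 r θ = conj a' * circleMap 0 1 θ := by
        simp only [ha', circleMap, map_mul, Complex.conj_ofReal]
        push_cast
        ring
      have h2 := half_one_sub_norm_sq_le ha ((hcm θ).trans_le hr.2.le)
      rw [← e1]
      set q := ‖1 - conj a * circleMap 0 r θ‖
      have hq : 0 < q := by linarith
      set d := 1 - ‖a‖ ^ 2
      have hdd : d ≤ 1 - ‖a'‖ ^ 2 := by
        have := pow_le_pow_left₀ (norm_nonneg a') ha'a 2
        simp only [d]; linarith
      -- Split off the Poisson kernel; the other factor is at most 2^(mP - 2), because d ≤ 2q and mP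
      -- ≥ 2.
      have e2 : d ^ (m * P - (2 + -1)) * q ^ (-(m * P)) = (d / q) ^ (m * P - 2) * (d * (q ^ 2)⁻¹) := by
        rw [Real.div_rpow hd.le hq.le, Real.rpow_neg hq.le,
          show (m * P - (2 + -1) : ℝ) = (m * P - 2) + 1 by ring, Real.rpow_add hd, Real.rpow_one,
          Real.rpow_sub hq, Real.rpow_two]
        have := Real.rpow_pos_of_pos hq (m * P)
        field_simp
      rw [e2]
      have e3 : (d / q) ^ (m * P - 2) ≤ b := by
        refine Real.rpow_le_rpow (by positivity) ?_ (by linarith)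
        rw [div_le_iff₀ hq]; linarith
      gcongr
    rw [eLpNorm_eq_lintegral_rpow_enorm_toReal hp.ne' hpt, ← hP, one_div]
    have hcoe : (((b ^ P⁻¹).toNNReal : ℝ≥0) : ℝ≥0∞) = ENNReal.ofReal b ^ P⁻¹ := by
      rw [ENNReal.ofReal_rpow_of_nonneg hb0 (by positivity)]; rfl
    rw [hcoe]
    gcongr
    calc _ ≤ ∫⁻ θ, ENNReal.ofReal b * ENNReal.ofReal ((1 - ‖a'‖ ^ 2) *
            (‖1 - conj a' * circleMap 0 1 θ‖ ^ 2)⁻¹) ∂μ := lintegral_mono hle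
      _ = ENNReal.ofReal b := by
          rw [lintegral_const_mul' _ _ ENNReal.ofReal_ne_top, lintegral_smul_measure,
            lintegral_circle_kernel ha'1, smul_eq_mul, ENNReal.inv_mul_cancel, mul_one]
          · simp [Real.pi_pos]
          · exact ENNReal.ofReal_ne_top
  · have hα' : -1 < α := lt_of_le_of_ne hα (Ne.symm hα1)
    have hα0 : 0 ≤ (1 + α) / Real.pi := div_nonneg (by linarith) Real.pi_pos.le
    set I : ℝ≥0∞ := ENNReal.ofReal ((1 + α) / Real.pi) * ∫⁻ z in ball (0 : ℂ) 1,
      ENNReal.ofReal ((2 : ℝ) ^ (m * P - 2 * (2 + α)) * (1 - ‖z‖ ^ 2) ^ α) with hI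
    have hItop : I ≠ ∞ := ENNReal.mul_ne_top ENNReal.ofReal_ne_top
      ((integrableOn_one_sub_norm_sq_rpow hα').const_mul _).lintegral_lt_top.ne
    have hIP : I ^ P⁻¹ ≠ ∞ := ENNReal.rpow_ne_top_of_nonneg (by positivity) hItop
    refine ⟨(I ^ P⁻¹).toNNReal, fun a ha f c hc hf => ?_⟩
    simp only [bergmanNorm, hpt, hα1, if_false]
    have hmem : ∀ᵐ z ∂discMeasure α, z ∈ ball (0 : ℂ) 1 :=
      (withDensity_absolutelyContinuous _ _).ae_le (ae_restrict_mem measurableSet_ball)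
    have h1 : ∀ᵐ z ∂discMeasure α, ‖f z‖ ≤ c * ‖k a z‖ := hmem.mono fun z hz => by
      rw [Real.norm_of_nonneg (hk0 a ha _)]
      exact hf z hz
    refine (eLpNorm_le_mul_eLpNorm_of_ae_le_mul h1 p).trans ?_
    rw [ENNReal.coe_toNNReal hIP, eLpNorm_eq_lintegral_rpow_enorm_toReal hp.ne' hpt, ← hP, one_div]
    gcongr
    simp only [discMeasure]
    refine (lintegral_withDensity_le_lintegral_mul _ (by fun_prop) _).trans ?_
    calc _ = ∫⁻ z in ball (0 : ℂ) 1, ENNReal.ofReal ((1 + α) / Real.pi) *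
          ENNReal.ofReal ((1 - ‖a‖ ^ 2) ^ (m * P - (2 + α)) * (1 - ‖z‖ ^ 2) ^ α *
            ‖1 - conj a * z‖ ^ (-(m * P))) := by
          refine setLIntegral_congr_fun measurableSet_ball fun z hz => ?_
          have := one_sub_norm_sq_pos (mem_ball_zero_iff.1 hz)
          simp only [Pi.mul_apply]
          rw [hkP a ha, ← ENNReal.ofReal_mul hα0, ← ENNReal.ofReal_mul]
          · congr 1; ring
          · have := Real.rpow_nonneg this.le α
            have : 0 ≤ 1 + α := by linarith
            have := Real.pi_pos
            positivity
      _ ≤ I := by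
          rw [lintegral_const_mul' _ _ ENNReal.ofReal_ne_top, hI]
          exact mul_le_mul_right (lintegral_ball_kernel_le ha ht) _

/-! ### Normalisation and locally uniform convergence -/

theorem one_sub_le_norm_one_sub_conj_mul {a z : ℂ} {ρ : ℝ} (ha : ‖a‖ ≤ 1) (hz : ‖z‖ ≤ ρ) :
    1 - ρ ≤ ‖1 - (starRingEnd ℂ) a * z‖ := by
  have h1 : ‖(starRingEnd ℂ) a * z‖ ≤ ρ := by
    rw [norm_mul, RCLike.norm_conj]
    exact (mul_le_of_le_one_left (norm_nonneg _) ha).trans hz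
  have h2 := norm_sub_norm_le (1 : ℂ) ((starRingEnd ℂ) a * z)
  rw [norm_one] at h2
  linarith

theorem IsCompact.exists_norm_le_of_subset_ball {K : Set ℂ} (hK : IsCompact K)
    (hKb : K ⊆ ball (0 : ℂ) 1) : ∃ ρ : ℝ, ρ < 1 ∧ ∀ z ∈ K, ‖z‖ ≤ ρ := by
  rcases K.eq_empty_or_nonempty with rfl | hne
  · exact ⟨0, zero_lt_one, by simp⟩
  · obtain ⟨z, hz, hmax⟩ := hK.exists_isMaxOn hne continuous_norm.continuousOn
    exact ⟨‖z‖, mem_ball_zero_iff.1 (hKb hz), fun w hw => hmax hw⟩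

theorem theorem3 (p : ℝ≥0∞) (hp : 0 < p) (α : ℝ) (hα : -1 ≤ α) (N : ℕ) :
    ∃ (C : ℝ≥0) (f : (Fin (N + 1) → Complex.UnitDisc) → Fin (N + 1) → ℂ → ℂ),
      (∀ (l : Fin (N + 1) → Complex.UnitDisc) (J : Fin (N + 1)),
        MemBergman p α (f l J) ∧
        bergmanNorm p α (f l J) ≤ (C : ℝ≥0∞) ∧
        iteratedDeriv (J : ℕ) (f l J) (l J : ℂ) =
          ((1 / (1 - ‖(l J : ℂ)‖ ^ 2) ^ ((2 + α) * (p⁻¹).toReal + ((J : ℕ) : ℝ)) : ℝ) : ℂ) ∧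
        ∀ k : Fin (N + 1), k ≠ J → iteratedDeriv (k : ℕ) (f l J) (l k : ℂ) = 0) ∧
      ∀ (J : Fin (N + 1)) (K : Set ℂ), IsCompact K → K ⊆ ball (0 : ℂ) 1 →
        TendstoUniformlyOn (fun l z => f l J z) (fun _ => 0)
          (comap minModulus (𝓝[<] (1 : ℝ))) K := by
  set s : ℝ := (2 + α) * (p⁻¹).toReal with hs
  have hs0 : 0 ≤ s := mul_nonneg (by linarith) ENNReal.toReal_nonneg
  obtain ⟨n, hn⟩ := exists_nat_ge (2 * s)
  -- The norm bound needs m ≥ 2s; the extra 1 gives m > s even if s = 0, as convergence to 0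
  -- requires.
  set m : ℕ := n + 1 with hm
  have hmn : (m : ℝ) = n + 1 := by push_cast [hm]; rfl
  obtain ⟨C, hC, hint⟩ := exists_interpolant N m
  obtain ⟨B, hB⟩ := exists_bergmanNorm_le_of_le_kernel hp hα (m := m) (by rw [← hs]; linarith)
  have hl1 : ∀ (l : Fin (N + 1) → Complex.UnitDisc) k, ‖(l k : ℂ)‖ < 1 := fun l k =>
    (l k).norm_lt_one
  choose g hgd hgle hgJ hgk using fun l : Fin (N + 1) → Complex.UnitDisc =>
    hint (fun k => (l k : ℂ)) (hl1 l)
  set f : (Fin (N + 1) → Complex.UnitDisc) → Fin (N + 1) → ℂ → ℂ := fun l J z =>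
    (((1 - ‖(l J : ℂ)‖ ^ 2) ^ (-s) : ℝ) : ℂ) * g l J z with hf
  have hfle : ∀ l J, ∀ z ∈ ball (0 : ℂ) 1, ‖f l J z‖ ≤
      C * ((1 - ‖(l J : ℂ)‖ ^ 2) ^ ((m : ℝ) - s) /
        ‖1 - (starRingEnd ℂ) (l J : ℂ) * z‖ ^ m) := fun l J z hz => by
    have hd := one_sub_norm_sq_pos (hl1 l J)
    have h1 := Real.rpow_nonneg hd.le (-s)
    simp only [hf]
    rw [norm_mul, Complex.norm_real, Real.norm_of_nonneg h1, sub_eq_add_neg (m : ℝ) s,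
      Real.rpow_add hd, Real.rpow_natCast]
    refine (mul_le_mul_of_nonneg_left (hgle l J z hz) h1).trans_eq ?_
    rw [div_pow]
    ring
  have hder : ∀ l J (k : ℕ) z, iteratedDeriv k (f l J) z =
      (((1 - ‖(l J : ℂ)‖ ^ 2) ^ (-s) : ℝ) : ℂ) * iteratedDeriv k (g l J) z :=
    fun l J k z => iteratedDeriv_const_mul_field _ _
  have hnorm : ∀ l J, bergmanNorm p α (f l J) ≤ ((C.toNNReal * B : ℝ≥0) : ℝ≥0∞) := fun l J => by
    rw [ENNReal.coe_mul]
    exact hB _ (hl1 l J) _ C hC (hfle l J)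
  refine ⟨C.toNNReal * B, f, fun l J => ⟨⟨?_, ?_⟩, hnorm l J, ?_, fun k hk => ?_⟩,
    fun J K hK hKb => ?_⟩
  · exact (hgd l J).const_mul _
  · exact (hnorm l J).trans_lt ENNReal.coe_lt_top
  · have hd := one_sub_norm_sq_pos (hl1 l J)
    rw [hder, hgJ, ← Complex.ofReal_mul, Real.rpow_add hd, Real.rpow_natCast, Real.rpow_neg hd.le,
      one_div, mul_inv]
  · rw [hder, hgk l J k hk, mul_zero]
  · obtain ⟨ρ, hρ, hKρ⟩ := hK.exists_norm_le_of_subset_ball hKb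
    have hρ' : 0 < 1 - ρ := by linarith
    have hms : 0 < (m : ℝ) - s := by linarith
    rw [Metric.tendstoUniformlyOn_iff]
    intro ε hε
    have hlim : Tendsto (fun x : ℝ => C * ((1 - x ^ 2) ^ ((m : ℝ) - s) / (1 - ρ) ^ m))
        (𝓝[<] 1) (𝓝 0) := by
      have hc : Continuous fun x : ℝ => C * ((1 - x ^ 2) ^ ((m : ℝ) - s) / (1 - ρ) ^ m) := by
        refine continuous_const.mul (Continuous.div_const ?_ _)
        exact Continuous.rpow_const (by fun_prop) fun _ => Or.inr hms.le
      have := (hc.tendsto 1).mono_left (nhdsWithin_le_nhds (s := Set.Iio 1))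
      simpa [Real.zero_rpow hms.ne'] using this
    refine ((hlim.eventually (gt_mem_nhds hε)).comap minModulus).mono fun l hl z hz => ?_
    rw [dist_zero_left]
    refine (hfle l J z (hKb hz)).trans_lt (lt_of_le_of_lt ?_ hl)
    have hd := one_sub_norm_sq_pos (hl1 l J)
    have h0 : 0 ≤ minModulus l := Finset.le_inf' _ _ fun _ _ => norm_nonneg _
    have h1 : minModulus l ≤ ‖(l J : ℂ)‖ := Finset.inf'_le _ (Finset.mem_univ J)
    have h2 := one_sub_le_norm_one_sub_conj_mul (hl1 l J).le (hKρ z hz)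
    have h3 : 1 - ‖(l J : ℂ)‖ ^ 2 ≤ 1 - minModulus l ^ 2 := by gcongr
    have h4 := Real.rpow_nonneg (hd.le.trans h3) ((m : ℝ) - s)
    gcongr
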